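/- A pospace is a topological space $X$ equipped with a partial order $\leq$ (no compatibility between order and topology is required), and a dimap is a continuous order-preserving map; $\mathbf{poTop}$ is the category of pospaces and dimaps. Let $I=[0,1]$, and let $(I,\Delta)$ be the pospace $I$ ordered by equality; $(X,\leq)\times(I,\Delta)$ is the topological product with the componentwise order. Two dimaps $f,g:X\to Y$ are dihomotopic if there is a dimap $H:(X,\leq)\times(I,\Delta)\to(Y,\leq)$ with $H(x,0)=f(x)$ and $H(x,1)=g(x)$ for all $x\in X$. A dimap $f:X\to Y$ is a dihomotopy equivalence if there is a dimap $g:Y\to X$ such that $f\circ g$ is dihomotopic to $\mathrm{id}_Y$ and $g\circ f$ is dihomotopic to $\mathrm{id}_X$. A difibration is a dimap with the right lifting property with respect to the inclusions $X\to(X,\leq)\times(I,\Delta)$, $x\mapsto(x,0)$, for all pospaces $X$; a dicofibration is a dimap with the left lifting property with respect to all trivial difibrations, i.e. difibrations that are dihomotopy equivalences. **Theorem.** The category $\mathbf{poTop}$ is a closed model category in which the weak equivalences are the dihomotopy equivalences, the fibrations are the difibrations, and the cofibrations are the dicofibrations. That is: $\mathbf{poTop}$ has finite limits and finite colimits; weak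 equivalences satisfy the two-out-of-three property; all three classes are closed under retracts; cofibrations have the left lifting property with respect to trivial fibrations, and trivial cofibrations with respect to fibrations (trivial means being also a weak equivalence); and every dimap factors both as a trivial cofibration followed by a fibration and as a cofibration followed by a trivial fibration. All pospaces are fibrant and cofibrant (the map to the final object is a fibration and the map from the initial object is a cofibration). Two dimaps $f,g:X\to Y$ are homotopic in this closed model category if and only if they are dihomotopic; here $f$ and $g$ are homotopic in the model category if, for some factorization of $(\mathrm{id}_X,\mathrm{id}_X):X\coprod X\to X$ into a cofibration $i:X\coprod X\to IX$ followed by a weak equivalence $r:IX\to X$, there is a dimap $h:IX\to Y$ with $h\circ i=(f,g):X\coprod X\to Y$. -/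

import Mathlib

open CategoryTheory Limits HomotopicalAlgebra
open scoped unitInterval

universe u

/-- A pospace: a topological space with a partial order on its points. No compatibility between
the order and the topology is required (in particular the order need not be closed). -/
structure PoTop : Type (u + 1) where
  of ::
  /-- The underlying set. -/
  carrier : Type u
  [top : TopologicalSpace carrier]
  [ord : PartialOrder carrier]

namespace PoTop

attribute [instance] PoTop.top PoTop.ord

instance : CoeSort PoTop.{u} (Type u) := ⟨PoTop.carrier⟩

/-- A dimap: a continuous order-preserving map. -/
@[ext]
structure Hom (X Y : PoTop.{u}) where
  /-- The underlying continuous order-preserving map. -/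
  hom' : X →Co Y

/-- The category of pospaces and dimaps. -/
instance : Category PoTop.{u} where
  Hom X Y := Hom X Y
  id X := ⟨ContinuousOrderHom.id X⟩
  comp f g := ⟨g.hom'.comp f.hom'⟩

instance : ConcreteCategory PoTop.{u} (fun X Y => X →Co Y) where
  hom := Hom.hom'
  ofHom := Hom.mk

/-- A continuous order-preserving map, seen as a morphism of the category of pospaces. -/
abbrev ofHom {X Y : PoTop.{u}} (f : X →Co Y) : X ⟶ Y :=
  ConcreteCategory.ofHom (C := PoTop.{u}) f

end PoTop

/-- The points of the pospace `(S, Δ)`: the topological space `S`, ordered by the diagonal,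
i.e. by equality. -/
def Diag (S : Type u) : Type u := S

namespace Diag

/-- A point of `S`, seen as a point of `(S, Δ)`. -/
def mk {S : Type u} (s : S) : Diag S := s

instance (S : Type u) [TopologicalSpace S] : TopologicalSpace (Diag S) :=
  inferInstanceAs (TopologicalSpace S)

instance (S : Type u) : PartialOrder (Diag S) where
  le s t := s = t
  le_refl _ := rfl
  le_trans _ _ _ h h' := Eq.trans h h'
  le_antisymm _ _ h _ := h

end Diag

namespace PoTop

/-- The cylinder `(X, ≤) × (I, Δ)`: the product space `X × [0,1]` with the componentwise order,
so that `(x, s) ≤ (y, t)` means `x ≤ y` and `s = t`. -/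
def cyl (X : PoTop.{u}) : PoTop.{u} := PoTop.of (X × Diag I)

/-- The point `(x, t)` of the cylinder on `X`. -/
def cylPoint {X : PoTop.{u}} (x : X) (t : I) : cyl X := (x, Diag.mk t)

/-- The inclusion `i₀ : (X, ≤) ⟶ (X, ≤) × (I, Δ)`, `x ↦ (x, 0)`, of the bottom of the cylinder. -/
def cylBot (X : PoTop.{u}) : X ⟶ cyl X :=
  ofHom
    { toFun := fun x => cylPoint x 0
      monotone' := fun _ _ h => ⟨h, le_refl _⟩
      continuous_toFun := Continuous.prodMk continuous_id continuous_const }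

/-- Two dimaps `f, g` are dihomotopic if there is a dimap `H : (X, ≤) × (I, Δ) ⟶ (Y, ≤)` with
`H (x, 0) = f x` and `H (x, 1) = g x`. -/
def Dihomotopic {X Y : PoTop.{u}} (f g : X ⟶ Y) : Prop :=
  ∃ H : cyl X ⟶ Y, (∀ x : X, H (cylPoint x 0) = f x) ∧ (∀ x : X, H (cylPoint x 1) = g x)

/-- The class of dihomotopy equivalences: the dimaps with a dihomotopy inverse. -/
def dihomotopyEquivalences : MorphismProperty PoTop.{u} := fun X Y f =>
  ∃ g : Y ⟶ X, Dihomotopic (g ≫ f) (𝟙 Y) ∧ Dihomotopic (f ≫ g) (𝟙 X)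

/-- The class of difibrations: the dimaps with the right lifting property with respect to
`i₀ : X ⟶ X × (I, Δ)` for all pospaces `X`. -/
def difibrations : MorphismProperty PoTop.{u} :=
  (MorphismProperty.ofHoms cylBot).rlp

/-- The class of dicofibrations: the dimaps with the left lifting property with respect to the
trivial difibrations, i.e. the difibrations that are dihomotopy equivalences. -/
def dicofibrations : MorphismProperty PoTop.{u} :=
  (difibrations ⊓ dihomotopyEquivalences).llp

end PoTop

/-- The homotopy relation of a model category, for morphisms from a cofibrant object `X` to a
fibrant object `Y`: for some factorization of the codiagonal `X ⨿ X ⟶ X` into a cofibration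
`i : X ⨿ X ⟶ IX` and a weak equivalence `r : IX ⟶ X`, there is `h : IX ⟶ Y` with
`i ≫ h = (f, g)`. -/
def ModelHomotopic {C : Type*} [Category* C] [ModelCategory C] {X Y : C} (f g : X ⟶ Y) : Prop :=
  ∃ (IX : C) (i : X ⨿ X ⟶ IX) (r : IX ⟶ X) (h : IX ⟶ Y),
    Cofibration i ∧ WeakEquivalence r ∧
      i ≫ r = coprod.desc (𝟙 X) (𝟙 X) ∧ i ≫ h = coprod.desc f g

/-!
# The Strøm model structure on pospaces

The order on `(I, Δ)` is equality, so that a homotopy `X × (I, Δ) ⟶ Y` is an ordinary homotopy whose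
stages are monotone, and a path in `Y` is any continuous map `I → Y`, with the pointwise order. This
makes the arguments of Strøm's model structure on topological spaces (Hurewicz fibrations, homotopy
equivalences) work, provided every auxiliary function with values in `I` is constant along the
order.

* *Limits and colimits.* Products, equalizers and coproducts are the evident ones. A coequalizer is
  the quotient by the relation "no coequalizing dimap separates the points", with the quotient
  topology and the order detected by all coequalizing dimaps.
* *Weak equivalences* are the dimaps that become isomorphisms in the category of dihomotopy classes,
  so that they have the two-out-of-three property and are stable under retracts.
* *The path factorization.* Every `f : X ⟶ Y` is an inclusion into a path object `pathFactor f`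
  followed by the endpoint map. The latter is a difibration. The former is a strong deformation
  retract and the zero set of a dimap to `(I, Δ)`, so that it lifts against all difibrations
  (`llp_difibrations_of_deformation`). The retract argument then gives: dimaps that lift against all
  difibrations are dihomotopy equivalences, and trivial dicofibrations lift against all
  difibrations.
* *Trivial difibrations* `p : E ⟶ B` have a section `s` with `𝟙 E` dihomotopic to `p ≫ s` over `B`
  (Dold's theorem, `exists_section_dihomotopicOver`). Hence they lift homotopies in `B` with both
  ends prescribed (`exists_cyl_lift`): lift from each end, join the two lifts by a dihomotopy over
  `B`, and restrict to the diagonal. So the ends of a cylinder, and the top of a mapping cylinder, are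
  dicofibrations, and the second factorization is the path factorization of the projection of the
  mapping cylinder.
* *Homotopies.* The cylinder `X × (I, Δ)` is thus a cylinder object, and the two ends of any
  cylinder object are dihomotopic, being sections of the same dihomotopy equivalence.
-/

namespace PoTop

/-! ### Dimaps and homotopies -/

lemma continuous_hom {X Y : PoTop.{u}} (f : X ⟶ Y) : Continuous f :=
  map_continuous (ConcreteCategory.hom f)

lemma monotone_hom {X Y : PoTop.{u}} (f : X ⟶ Y) : Monotone f :=
  (ConcreteCategory.hom f).monotone'

/-- A dimap, given by a function that is continuous and monotone. -/
def mkHom {X Y : PoTop.{u}} (f : X → Y) (hc : Continuous f) (hm : Monotone f) : X ⟶ Y :=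
  ofHom { toFun := f, monotone' := hm, continuous_toFun := hc }

@[simp]
lemma mkHom_apply {X Y : PoTop.{u}} (f : X → Y) (hc : Continuous f) (hm : Monotone f) (x : X) :
    mkHom f hc hm x = f x := rfl

/-- A dimap on a cylinder, given by a function of two variables that is jointly continuous, and
monotone in the first variable. No monotonicity in the second is asked for, as `(I, Δ)` is ordered
by equality. -/
def cylHom {X Y : PoTop.{u}} (F : X → I → Y) (hc : Continuous fun z : X × I => F z.1 z.2)
    (hm : ∀ t, Monotone fun x => F x t) : cyl X ⟶ Y :=
  mkHom (X := cyl X) (fun z : X × Diag I => F z.1 z.2) hc (by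
    rintro ⟨x, t⟩ ⟨x', t'⟩ ⟨h, h' : t = t'⟩
    subst h'
    exact hm t h)

@[simp]
lemma cylHom_apply {X Y : PoTop.{u}} (F : X → I → Y) (hc : Continuous fun z : X × I => F z.1 z.2)
    (hm : ∀ t, Monotone fun x => F x t) (x : X) (t : I) :
    cylHom F hc hm (cylPoint x t) = F x t := rfl

lemma cyl_hom_ext {X Y : PoTop.{u}} {f g : cyl X ⟶ Y}
    (h : ∀ (x : X) (t : I), f (cylPoint x t) = g (cylPoint x t)) : f = g :=
  ConcreteCategory.hom_ext _ _ fun z => h z.1 z.2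

@[simp]
lemma cylBot_apply {X : PoTop.{u}} (x : X) : cylBot X x = cylPoint x 0 := rfl

lemma continuous_cylPoint (X : PoTop.{u}) :
    Continuous (Y := cyl X) fun z : X × I => cylPoint z.1 z.2 :=
  (continuous_id : Continuous (id : X × I → X × I))

lemma continuous_cyl {X Y : PoTop.{u}} (H : cyl X ⟶ Y) {W : Type*} [TopologicalSpace W]
    {a : W → X} {b : W → I} (ha : Continuous a) (hb : Continuous b) :
    Continuous fun w => H (cylPoint (a w) (b w)) :=
  (continuous_hom H).comp ((continuous_cylPoint X).comp (ha.prodMk hb))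

lemma monotone_cyl {X Y : PoTop.{u}} (H : cyl X ⟶ Y) (t : I) :
    Monotone fun x => H (cylPoint x t) :=
  fun _ _ h => monotone_hom H ⟨h, le_refl _⟩

/-- The projection of the cylinder to its base. -/
def cylProj (X : PoTop.{u}) : cyl X ⟶ X :=
  cylHom (fun x _ => x) continuous_fst fun _ _ _ h => h

/-- The inclusion `x ↦ (x, 1)` of the top of the cylinder. -/
def cylTop (X : PoTop.{u}) : X ⟶ cyl X :=
  mkHom (fun x => cylPoint x 1) ((continuous_cylPoint X).comp (.prodMk_left 1))
    fun _ _ h => ⟨h, le_refl _⟩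

@[simp]
lemma cylTop_apply {X : PoTop.{u}} (x : X) : cylTop X x = cylPoint x 1 := rfl

@[simp]
lemma cylProj_apply {X : PoTop.{u}} (x : X) (t : I) : cylProj X (cylPoint x t) = x := rfl

/-- The truncation of a real number to `[0, 1]`. -/
noncomputable def clamp (s : ℝ) : I := Set.projIcc 0 1 zero_le_one s

@[fun_prop]
lemma continuous_clamp : Continuous clamp := continuous_projIcc (h := zero_le_one)

lemma clamp_of_nonpos {s : ℝ} (h : s ≤ 0) : clamp s = 0 := Set.projIcc_of_le_left _ h

lemma clamp_of_one_le {s : ℝ} (h : 1 ≤ s) : clamp s = 1 := Set.projIcc_of_right_le _ h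

@[simp] lemma clamp_coe (t : I) : clamp t = t := Set.projIcc_val _ t

@[simp] lemma clamp_zero : clamp 0 = 0 := clamp_of_nonpos le_rfl

@[simp] lemma clamp_one : clamp 1 = 1 := clamp_of_one_le le_rfl

lemma coe_clamp {s : ℝ} (h0 : 0 ≤ s) (h1 : s ≤ 1) : (clamp s : ℝ) = s := by
  rw [clamp, Set.projIcc_of_mem _ ⟨h0, h1⟩]

/-- The concatenation of two homotopies, described by its values on the two halves. -/
lemma exists_concat {X Y : PoTop.{u}} (H H' : cyl X ⟶ Y)
    (h : ∀ x : X, H (cylPoint x 1) = H' (cylPoint x 0)) :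
    ∃ K : cyl X ⟶ Y,
      (∀ (x : X) (t : I), (t : ℝ) ≤ 1 / 2 →
        K (cylPoint x t) = H (cylPoint x (clamp (2 * t)))) ∧
      (∀ (x : X) (t : I), 1 / 2 ≤ (t : ℝ) →
        K (cylPoint x t) = H' (cylPoint x (clamp (2 * t - 1)))) := by
  have key (x : X) (t : I) (ht : (t : ℝ) = 1 / 2) :
      H (cylPoint x (clamp (2 * t))) = H' (cylPoint x (clamp (2 * t - 1))) := by
    simpa [ht] using h x
  let F (x : X) (t : I) : Y := if (t : ℝ) ≤ 1 / 2 then H (cylPoint x (clamp (2 * t)))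
    else H' (cylPoint x (clamp (2 * t - 1)))
  have hF (x : X) (t : I) (ht : (t : ℝ) ≤ 1 / 2) : F x t = H (cylPoint x (clamp (2 * t))) :=
    if_pos ht
  have hF' (x : X) (t : I) (ht : 1 / 2 ≤ (t : ℝ)) :
      F x t = H' (cylPoint x (clamp (2 * t - 1))) := by
    rcases ht.eq_or_lt with ht | ht
    · rw [hF x t ht.ge, key x t ht.symm]
    · exact if_neg ht.not_ge
  refine ⟨cylHom F ?_ ?_, hF, hF'⟩
  · refine Continuous.if_le ?_ ?_ (by fun_prop) continuous_const fun z hz => key z.1 z.2 hz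
    · exact continuous_cyl H (by fun_prop) (by fun_prop)
    · exact continuous_cyl H' (by fun_prop) (by fun_prop)
  · intro t x x' hx
    rcases le_total (t : ℝ) (1 / 2) with ht | ht
    · simpa only [hF _ t ht] using monotone_cyl H _ hx
    · simpa only [hF' _ t ht] using monotone_cyl H' _ hx

/-- The homotopy `H` run backwards. -/
def cylRev {X Y : PoTop.{u}} (H : cyl X ⟶ Y) : cyl X ⟶ Y :=
  cylHom (fun x t => H (cylPoint x (σ t))) (continuous_cyl H (by fun_prop) (by fun_prop))
    fun _ => monotone_cyl H _

@[simp]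
lemma cylRev_apply {X Y : PoTop.{u}} (H : cyl X ⟶ Y) (x : X) (t : I) :
    cylRev H (cylPoint x t) = H (cylPoint x (σ t)) := rfl

/-- Two dimaps `f, g : X ⟶ E` are dihomotopic over `p : E ⟶ B` if they are joined by a dihomotopy
that moves every point inside its fibre of `p`. (So `f ≫ p = g ≫ p`.) -/
def DihomotopicOver {X E B : PoTop.{u}} (p : E ⟶ B) (f g : X ⟶ E) : Prop :=
  ∃ H : cyl X ⟶ E, (∀ x : X, H (cylPoint x 0) = f x) ∧ (∀ x : X, H (cylPoint x 1) = g x) ∧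
    ∀ (x : X) (t : I), p (H (cylPoint x t)) = p (f x)

namespace DihomotopicOver

variable {W X E B : PoTop.{u}} {p : E ⟶ B} {f g h : X ⟶ E}

lemma comp_eq (hfg : DihomotopicOver p f g) (x : X) : p (g x) = p (f x) := by
  obtain ⟨H, _, h1, h2⟩ := hfg
  rw [← h1, h2]

lemma symm (hfg : DihomotopicOver p f g) : DihomotopicOver p g f := by
  have h' := hfg.comp_eq
  obtain ⟨H, h0, h1, h2⟩ := hfg
  exact ⟨cylRev H, by simp [h1], by simp [h0], by simp [h2, h']⟩

lemma trans (hfg : DihomotopicOver p f g) (hgh : DihomotopicOver p g h) :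
    DihomotopicOver p f h := by
  have h' := hfg.comp_eq
  obtain ⟨H, h0, h1, h2⟩ := hfg
  obtain ⟨H', h0', h1', h2'⟩ := hgh
  obtain ⟨K, k, k'⟩ := exists_concat H H' (by simp [h1, h0'])
  refine ⟨K, fun x => ?_, fun x => ?_, fun x t => ?_⟩
  · rw [k x 0 (by norm_num)]
    simp [h0]
  · rw [k' x 1 (by norm_num)]
    norm_num [h1']
  · rcases le_total (t : ℝ) (1 / 2) with ht | ht
    · rw [k x t ht, h2]
    · rw [k' x t ht, h2', h']

lemma precomp (a : W ⟶ X) (hfg : DihomotopicOver p f g) :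
    DihomotopicOver p (a ≫ f) (a ≫ g) := by
  obtain ⟨H, h0, h1, h2⟩ := hfg
  exact ⟨cylHom (fun x t => H (cylPoint (a x) t))
    (continuous_cyl H ((continuous_hom a).comp continuous_fst) continuous_snd)
    fun t => (monotone_cyl H t).comp (monotone_hom a),
    by simp [h0], by simp [h1], by simp [h2]⟩

lemma dihomotopic (hfg : DihomotopicOver p f g) : Dihomotopic f g := by
  obtain ⟨H, h0, h1, _⟩ := hfg
  exact ⟨H, h0, h1⟩

end DihomotopicOver

/-- The one-point pospace. -/
def point : PoTop.{u} := of PUnit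

/-- The map to the one-point pospace. -/
def toPoint (X : PoTop.{u}) : X ⟶ point :=
  mkHom (fun _ => PUnit.unit) continuous_const monotone_const

lemma dihomotopic_iff_dihomotopicOver_toPoint {X Y : PoTop.{u}} {f g : X ⟶ Y} :
    Dihomotopic f g ↔ DihomotopicOver (toPoint Y) f g :=
  ⟨fun ⟨H, h0, h1⟩ => ⟨H, h0, h1, fun _ _ => rfl⟩, fun h => h.dihomotopic⟩

/-- Dihomotopy, as a relation on the morphisms of the category of pospaces. -/
abbrev dihomotopyRel : HomRel PoTop.{u} := fun _ _ f g => Dihomotopic f g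

instance : Congruence dihomotopyRel.{u} where
  comp_left f _ _ h :=
    ((dihomotopic_iff_dihomotopicOver_toPoint.1 h).precomp f).dihomotopic
  comp_right g h := by
    obtain ⟨H, h0, h1⟩ := h
    exact ⟨H ≫ g, by simp [h0], by simp [h1]⟩
  equivalence :=
    { refl := fun f => ⟨cylProj _ ≫ f, by simp, by simp⟩
      symm := fun h => (dihomotopic_iff_dihomotopicOver_toPoint.1 h).symm.dihomotopic
      trans := fun h h' => ((dihomotopic_iff_dihomotopicOver_toPoint.1 h).trans
        (dihomotopic_iff_dihomotopicOver_toPoint.1 h')).dihomotopic }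

/-- The functor to the category of pospaces and dihomotopy classes of dimaps. -/
abbrev toDihomotopyCategory :
    PoTop.{u} ⥤ CategoryTheory.Quotient dihomotopyRel.{u} :=
  Quotient.functor _

lemma toDihomotopyCategory_map_eq_iff {X Y : PoTop.{u}} {f g : X ⟶ Y} :
    toDihomotopyCategory.map f = toDihomotopyCategory.map g ↔ Dihomotopic f g :=
  Quotient.functor_map_eq_iff dihomotopyRel f g

/-- Dihomotopy equivalences are the dimaps that become invertible up to dihomotopy. They inherit the
two-out-of-three property and stability under retracts from isomorphisms. -/
lemma dihomotopyEquivalences_eq :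
    dihomotopyEquivalences.{u} =
      (MorphismProperty.isomorphisms _).inverseImage toDihomotopyCategory := by
  ext X Y f
  rw [MorphismProperty.inverseImage_iff, MorphismProperty.isomorphisms.iff]
  constructor
  · rintro ⟨g, h, h'⟩
    rw [← toDihomotopyCategory_map_eq_iff] at h h'
    exact ⟨toDihomotopyCategory.map g, by simpa using h', by simpa using h⟩
  · intro hf
    obtain ⟨g, hg⟩ := toDihomotopyCategory.map_surjective (inv (toDihomotopyCategory.map f))
    exact ⟨g, by simp [← toDihomotopyCategory_map_eq_iff, hg],
      by simp [← toDihomotopyCategory_map_eq_iff, hg]⟩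

lemma dihomotopyEquivalences_id (X : PoTop.{u}) : dihomotopyEquivalences (𝟙 X) := by
  rw [dihomotopyEquivalences_eq]
  exact MorphismProperty.id_mem _ X

instance : dihomotopyEquivalences.{u}.HasTwoOutOfThreeProperty := by
  rw [dihomotopyEquivalences_eq]
  infer_instance

instance : dihomotopyEquivalences.{u}.IsStableUnderRetracts := by
  rw [dihomotopyEquivalences_eq]
  infer_instance

/-! ### Difibrations and the homotopy lifting property -/

lemma difibrations_iff {E B : PoTop.{u}} (p : E ⟶ B) :
    difibrations p ↔ ∀ (Z : PoTop.{u}) (a : Z ⟶ E) (H : cyl Z ⟶ B),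
      (∀ z : Z, H (cylPoint z 0) = p (a z)) →
      ∃ L : cyl Z ⟶ E, (∀ z : Z, L (cylPoint z 0) = a z) ∧ L ≫ p = H := by
  constructor
  · intro hp Z a H h
    have : HasLiftingProperty (cylBot Z) p := hp _ (.mk Z)
    have sq : CommSq a (cylBot Z) p H := ⟨ConcreteCategory.hom_ext _ _ fun z => by simp [h]⟩
    exact ⟨sq.lift, fun z => by rw [← cylBot_apply, ← ConcreteCategory.comp_apply, sq.fac_left],
      sq.fac_right⟩
  · rintro hp Z _ _ ⟨_⟩
    refine ⟨fun {a H} sq => ?_⟩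
    obtain ⟨L, h0, h⟩ := hp Z a H fun z => by
      rw [← cylBot_apply, ← ConcreteCategory.comp_apply, ← sq.w, ConcreteCategory.comp_apply]
    exact ⟨⟨⟨L, ConcreteCategory.hom_ext _ _ fun z => by simp [h0], h⟩⟩⟩

variable {X E B : PoTop.{u}} {p : E ⟶ B}

/-- The two ends of a homotopy `F` in `E` are dihomotopic over `B` as soon as the paths
`t ↦ p (F (x, t))` are contracted, relative to their endpoints, by a homotopy `C`: lift `C` with
`F` as initial condition, and walk along the three other sides of the square. -/
lemma dihomotopicOver_of_contraction (hp : difibrations p) (F : cyl X ⟶ E) (C : cyl (cyl X) ⟶ B)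
    (h : ∀ (x : X) (t : I), C (cylPoint (cylPoint x t) 0) = p (F (cylPoint x t)))
    (hbot : ∀ (x : X) (u : I), C (cylPoint (cylPoint x 0) u) = p (F (cylPoint x 0)))
    (htop : ∀ (x : X) (u : I), C (cylPoint (cylPoint x 1) u) = p (F (cylPoint x 0)))
    (hend : ∀ (x : X) (t : I), C (cylPoint (cylPoint x t) 1) = p (F (cylPoint x 0))) :
    DihomotopicOver p (cylBot X ≫ F) (cylTop X ≫ F) := by
  obtain ⟨L, hL, rfl⟩ := (difibrations_iff p).1 hp _ F C fun z => h z.1 z.2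
  have hL' (x : X) (t : I) : L (cylPoint (cylPoint x t) 0) = F (cylPoint x t) := hL _
  simp only [ConcreteCategory.comp_apply] at h hbot htop hend
  have side (s : I) (hs : ∀ (x : X) (u : I),
      p (L (cylPoint (cylPoint x s) u)) = p (F (cylPoint x 0))) :
      DihomotopicOver p (mkHom (fun x => F (cylPoint x s))
        (continuous_cyl F continuous_id continuous_const) (monotone_cyl F s))
        (mkHom (fun x => L (cylPoint (cylPoint x s) 1))
        (continuous_cyl L ((continuous_cylPoint X).comp (.prodMk_left s)) continuous_const)
        ((monotone_cyl L 1).comp fun _ _ h => ⟨h, le_refl _⟩)) := by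
    refine ⟨cylHom (fun x u => L (cylPoint (cylPoint x s) u)) ?_ ?_, ?_, ?_, ?_⟩
    · exact continuous_cyl L ((continuous_cylPoint X).comp
        (continuous_fst.prodMk continuous_const)) continuous_snd
    · exact fun t => (monotone_cyl L t).comp fun _ _ h => ⟨h, le_refl _⟩
    · simp [hL']
    · simp
    · simp only [cylHom_apply, mkHom_apply]
      intro x u
      rw [hs, ← h x s, hs]
  refine (side 0 hbot).trans (DihomotopicOver.trans ?_ (side 1 htop).symm)
  refine ⟨cylHom (fun x t => L (cylPoint (cylPoint x t) 1)) ?_ ?_, ?_, ?_, ?_⟩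
  · exact continuous_cyl L (continuous_cylPoint X) continuous_const
  · exact fun t => (monotone_cyl L 1).comp fun _ _ h => ⟨h, le_refl _⟩
  · simp
  · simp
  · simp [hend]

/-- A trivial difibration has a section `s`, and retracts to its image fibrewise. -/
theorem exists_section_dihomotopicOver (hp : difibrations p) (hw : dihomotopyEquivalences p) :
    ∃ s : B ⟶ E, s ≫ p = 𝟙 B ∧ DihomotopicOver p (𝟙 E) (p ≫ s) := by
  obtain ⟨g, ⟨H, H0, H1⟩, hg⟩ := hw
  obtain ⟨L, L0, hL⟩ := (difibrations_iff p).1 hp _ g H fun z => by simp [H0]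
  -- The dihomotopy inverse `g` is deformed into a section, by lifting `g ≫ p ∼ 𝟙`.
  let s : B ⟶ E := cylTop B ≫ L
  have hs : s ≫ p = 𝟙 B := by
    ext x
    simp only [s, Category.assoc, hL]
    simp [H1]
  have hs' (b : B) : p (s b) = b := by
    rw [← ConcreteCategory.comp_apply, hs, ConcreteCategory.id_apply]
  obtain ⟨K, K0, K1⟩ : Dihomotopic (𝟙 E) (p ≫ s) := by
    have hgs : Dihomotopic g s := ⟨L, L0, fun _ => rfl⟩
    rw [← toDihomotopyCategory_map_eq_iff] at hg hgs ⊢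
    rw [← hg, Functor.map_comp, Functor.map_comp, hgs]
  simp only [ConcreteCategory.id_apply, ConcreteCategory.comp_apply] at K0 K1
  refine ⟨s, hs, ?_⟩
  -- Follow `K` from `𝟙 E` to `p ≫ s`, and then the reverse of the shadow of `K` in the section.
  obtain ⟨F, F1, F2⟩ := exists_concat K (cylRev (K ≫ p ≫ s)) fun x => by simp [K1, hs']
  have pF (x : E) (t : I) :
      p (F (cylPoint x t)) = p (K (cylPoint x (clamp (1 - |1 - 2 * (t : ℝ)|)))) := by
    rcases le_total (t : ℝ) (1 / 2) with ht | ht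
    · rw [F1 x t ht, abs_of_nonneg (by linarith)]
      ring_nf
    · rw [F2 x t ht, abs_of_nonpos (by linarith)]
      simp only [cylRev_apply, ConcreteCategory.comp_apply, hs']
      congr 3
      ext
      rw [unitInterval.coe_symm_eq, coe_clamp (by linarith) (by linarith [t.2.2]),
        coe_clamp (by linarith [t.2.2]) (by linarith)]
      ring
  have Fbot (x : E) : F (cylPoint x 0) = x := by
    rw [F1 x 0 (by norm_num)]
    simp [K0]
  have Ftop (x : E) : F (cylPoint x 1) = s (p x) := by
    rw [F2 x 1 (by norm_num)]
    norm_num [K0]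
  have cont : Continuous fun w : (E × I) × I =>
      p (K (cylPoint w.1.1 (clamp ((1 - |1 - 2 * (w.1.2 : ℝ)|) * (1 - w.2))))) :=
    (continuous_hom p).comp (continuous_cyl K (by fun_prop) (by fun_prop))
  let C : cyl (cyl E) ⟶ B := cylHom (X := cyl E)
    (fun (z : E × I) (u : I) => p (K (cylPoint z.1 (clamp ((1 - |1 - 2 * (z.2 : ℝ)|) * (1 - u))))))
    cont (by
      rintro u ⟨x, t⟩ ⟨x', t'⟩ ⟨h, h' : t = t'⟩
      subst h'
      exact monotone_hom p (monotone_cyl K _ h))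
  have hC (x : E) (t u : I) : C (cylPoint (cylPoint x t) u) =
      p (K (cylPoint x (clamp ((1 - |1 - 2 * (t : ℝ)|) * (1 - u))))) := rfl
  have := dihomotopicOver_of_contraction hp F C (fun x t => by simp [hC, pF])
    (fun x u => by simp [hC, Fbot, K0]) (fun x u => by norm_num [hC, Fbot, K0])
    (fun x t => by simp [hC, Fbot, K0])
  have e0 : cylBot E ≫ F = 𝟙 E := ConcreteCategory.hom_ext _ _ fun x => by simp [Fbot]
  have e1 : cylTop E ≫ F = p ≫ s := ConcreteCategory.hom_ext _ _ fun x => by simp [Ftop]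
  rwa [e0, e1] at this

/-- A trivial difibration has the right lifting property with respect to `X × {0, 1} ⟶ X × I`. -/
theorem exists_cyl_lift (hp : difibrations p) (hw : dihomotopyEquivalences p) (e₀ e₁ : X ⟶ E)
    (h : cyl X ⟶ B) (h₀ : ∀ x : X, h (cylPoint x 0) = p (e₀ x))
    (h₁ : ∀ x : X, h (cylPoint x 1) = p (e₁ x)) :
    ∃ F : cyl X ⟶ E, (∀ x : X, F (cylPoint x 0) = e₀ x) ∧
      (∀ x : X, F (cylPoint x 1) = e₁ x) ∧ F ≫ p = h := by
  obtain ⟨s, hs, hps⟩ := exists_section_dihomotopicOver hp hw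
  obtain ⟨L₀, hL₀, hL₀'⟩ := (difibrations_iff p).1 hp _ e₀ h h₀
  obtain ⟨L₁, hL₁, hL₁'⟩ := (difibrations_iff p).1 hp _ e₁ (cylRev h) (by simp [h₁])
  have hL₁'' : cylRev L₁ ≫ p = h := cyl_hom_ext fun x t => by
    have := ConcreteCategory.congr_hom hL₁' (cylPoint x (σ t))
    simpa using this
  -- `L₀` starts at `e₀` and the reverse of `L₁` ends at `e₁`. Both lift `h`, so that each is
  -- dihomotopic over `B` to `h ≫ s`; the diagonal of such a dihomotopy has both ends right.
  have : DihomotopicOver p L₀ (cylRev L₁) := by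
    have h0 := hps.precomp L₀
    have h1 := hps.precomp (cylRev L₁)
    rw [Category.comp_id, ← Category.assoc] at h0 h1
    rw [hL₀'] at h0
    rw [hL₁''] at h1
    exact h0.trans h1.symm
  obtain ⟨G, G0, G1, hG⟩ := this
  refine ⟨cylHom (fun x t => G (cylPoint (cylPoint x t) t)) ?_ ?_, ?_, ?_, ?_⟩
  · exact continuous_cyl G (continuous_cylPoint X) continuous_snd
  · exact fun t => (monotone_cyl G t).comp fun _ _ h => ⟨h, le_refl _⟩
  · simp [G0, hL₀]
  · simp [G1, hL₁]
  · refine cyl_hom_ext fun x t => ?_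
    rw [← hL₀']
    simp [hG]

/-! ### Strong deformation retracts cut out by a function -/

/-- A pospace `X` that deforms to `A` by a homotopy `H` relative to `A`, where `A` is the zero set
of a dimap `φ : X ⟶ (I, Δ)`: the inclusion has the left lifting property with respect to
difibrations. Indeed, run on the time scale `φ`, the deformation gives a dimap
`D (x, t) = H (x, t / φ x)` with `D (x, φ x) = x`, so that a lift of `D` restricts to a lift on
`X` along `x ↦ (x, φ x)`. -/
theorem llp_difibrations_of_deformation {A X : PoTop.{u}} (i : A ⟶ X) (r : X ⟶ A) (φ : X → I)
    (hφ : Continuous φ) (hφ' : ∀ ⦃x y : X⦄, x ≤ y → φ x = φ y) (hφi : ∀ a : A, φ (i a) = 0)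
    (hir : i ≫ r = 𝟙 A) (H : cyl X ⟶ X) (H0 : ∀ x : X, H (cylPoint x 0) = i (r x))
    (H1 : ∀ x : X, H (cylPoint x 1) = x)
    (Hrel : ∀ (x : X) (t : I), φ x = 0 → H (cylPoint x t) = x) :
    difibrations.llp i := by
  let D₀ (x : X) (t : I) : X := H (cylPoint x (clamp ((t : ℝ) / φ x)))
  have cont : Continuous fun z : X × I => D₀ z.1 z.2 := by
    rw [continuous_iff_continuousAt]
    rintro ⟨x₀, t₀⟩
    by_cases h : φ x₀ = 0
    · -- By compactness of `I`, points near `x₀` stay near `x₀ = H (x₀, t)` for all `t` at once.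
      have h₀ : D₀ x₀ t₀ = x₀ := Hrel _ _ h
      rw [ContinuousAt, h₀]
      intro U hU
      have hU' : ∀ᶠ x in nhds x₀, ∀ t ∈ (Set.univ : Set I), H (cylPoint x t) ∈ U := by
        refine isCompact_univ.eventually_forall_of_forall_eventually fun t _ => ?_
        refine (continuous_cyl H continuous_fst continuous_snd).continuousAt ?_
        rwa [Hrel _ _ h]
      exact (continuousAt_fst.eventually hU').mono fun z hz => hz _ trivial
    · have h' : (φ x₀ : ℝ) ≠ 0 := fun h' => h (Subtype.ext h')
      have c : ContinuousAt (fun z : X × I => ((z.2 : ℝ) / φ z.1)) (x₀, t₀) :=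
        ContinuousAt.div (by fun_prop) (by fun_prop) h'
      exact ((continuous_hom H).comp (continuous_cylPoint X)).continuousAt.comp
        (continuousAt_fst.prodMk (continuous_clamp.continuousAt.comp c))
  let D : cyl X ⟶ X := cylHom D₀ cont fun t x y h => by
    simp only [D₀, hφ' h]
    exact monotone_cyl H _ h
  have D_apply (x : X) (t : I) : D (cylPoint x t) = H (cylPoint x (clamp ((t : ℝ) / φ x))) := rfl
  intro E B p hp
  refine ⟨fun {a b} sq => ?_⟩
  have hab (x : A) : b (i x) = p (a x) := by
    simp only [← ConcreteCategory.comp_apply, sq.w]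
  have hir' (x : A) : r (i x) = x := by
    rw [← ConcreteCategory.comp_apply, hir, ConcreteCategory.id_apply]
  obtain ⟨L, hL, hL'⟩ := (difibrations_iff p).1 hp _ (r ≫ a) (D ≫ b) fun x => by
    simp [D_apply, H0, hab]
  let F : X ⟶ E := mkHom (fun x => L (cylPoint x (φ x))) (continuous_cyl L continuous_id hφ)
    fun x y h => by
      simp only [hφ' h]
      exact monotone_cyl L _ h
  have F_apply (x : X) : F x = L (cylPoint x (φ x)) := rfl
  refine ⟨⟨⟨F, ConcreteCategory.hom_ext _ _ fun x => ?_,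
    ConcreteCategory.hom_ext _ _ fun x => ?_⟩⟩⟩
  · simp [F_apply, hφi, hL, hir']
  · have h1 : D (cylPoint x (φ x)) = x := by
      rw [D_apply]
      by_cases h : φ x = 0
      · exact Hrel _ _ h
      · rw [div_self fun h' => h (Subtype.ext h'), clamp_one, H1]
    have := ConcreteCategory.congr_hom hL' (cylPoint x (φ x))
    simpa [F_apply, h1] using this

/-! ### The path factorization -/

section PathFactor

variable {X Y : PoTop.{u}} (f : X ⟶ Y)

/-- The path object of `f : X ⟶ Y`: triples of a point `x` of `X`, a path `γ` in `Y` that starts at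
`f x`, and a number `r` in `(I, Δ)`, which has to be positive unless `γ` is constant. Paths are
continuous maps `I → Y`, not required to be monotone, and are compared pointwise. The number `r`
makes the copy of `X` in the path object, given by the constant paths with `r = 0`, the zero set of
a continuous function, which is what `llp_difibrations_of_deformation` asks for; with `(x, γ)` alone
this fails, as the constant paths need not be a zero set. -/
def pathFactor : PoTop.{u} :=
  of {e : X × C(I, Y) × Diag I //
    e.2.1 0 = f e.1 ∧ (e.2.2 = Diag.mk (0 : I) → ∀ s, e.2.1 s = f e.1)}

namespace pathFactor

variable {f}

/-- The triple `(x, γ, r)`, as a point of the path object. -/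
def mk (x : X) (γ : C(I, Y)) (r : I) (h : γ 0 = f x) (h' : r = 0 → ∀ s, γ s = f x) :
    pathFactor f :=
  ⟨(x, γ, Diag.mk r), h, h'⟩

/-- The point of `X`. -/
def base (e : pathFactor f) : X := e.1.1

/-- The path in `Y`. -/
def path (e : pathFactor f) : C(I, Y) := e.1.2.1

/-- The number `r` of a point `(x, γ, r)` of the path object; it vanishes exactly on the copy
of `X`. -/
def scale (e : pathFactor f) : I := e.1.2.2

lemma path_zero (e : pathFactor f) : path e 0 = f (base e) := e.2.1

lemma path_eq_of_scale_eq_zero {e : pathFactor f} (h : scale e = 0) (s : I) :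
    path e s = f (base e) := e.2.2 h s

lemma ext {e e' : pathFactor f} (h : base e = base e') (h' : ∀ s, path e s = path e' s)
    (h'' : scale e = scale e') : e = e' :=
  Subtype.ext (Prod.ext h (Prod.ext (ContinuousMap.ext h') h''))

lemma le_iff {e e' : pathFactor f} :
    e ≤ e' ↔ base e ≤ base e' ∧ (∀ s, path e s ≤ path e' s) ∧ scale e = scale e' := Iff.rfl

lemma continuous_base : Continuous (base : pathFactor f → X) :=
  continuous_fst.comp continuous_subtype_val

lemma continuous_path : Continuous (path : pathFactor f → C(I, Y)) :=
  (continuous_fst.comp continuous_snd).comp continuous_subtype_val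

lemma continuous_scale : Continuous (scale : pathFactor f → I) :=
  (continuous_snd.comp continuous_snd).comp continuous_subtype_val

lemma continuous_iff {W : Type*} [TopologicalSpace W] {F : W → pathFactor f} :
    Continuous F ↔ Continuous (fun w => base (F w)) ∧
      Continuous (fun w : W × I => path (F w.1) w.2) ∧ Continuous fun w => scale (F w) := by
  refine ⟨fun h => ⟨continuous_base.comp h, ?_, continuous_scale.comp h⟩,
    fun ⟨h1, h2, h3⟩ => ?_⟩
  · exact continuous_eval.comp (((continuous_path.comp h).comp continuous_fst).prodMk
      continuous_snd)
  · exact Continuous.subtype_mk (h1.prodMk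
      ((ContinuousMap.continuous_of_continuous_uncurry (fun w => path (F w)) h2).prodMk h3)) _

variable (f)

/-- The inclusion of `X` into the path object, by constant paths. -/
def incl : X ⟶ pathFactor f :=
  mkHom (fun x => mk x (.const I (f x)) 0 rfl fun _ _ => rfl)
    (continuous_iff.2 ⟨continuous_id, (continuous_hom f).comp continuous_fst, continuous_const⟩)
    fun _ _ h => le_iff.2 ⟨h, fun _ => monotone_hom f h, rfl⟩

/-- The projection of the path object to `X`. -/
def proj : pathFactor f ⟶ X :=
  mkHom base continuous_base fun _ _ h => (le_iff.1 h).1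

/-- The endpoint map of the path object. -/
def endpoint : pathFactor f ⟶ Y :=
  mkHom (fun e => path e 1) ((continuous_eval_const 1).comp continuous_path)
    fun _ _ h => (le_iff.1 h).2.1 1

lemma incl_endpoint : incl f ≫ endpoint f = f := rfl

lemma incl_proj : incl f ≫ proj f = 𝟙 X := rfl

/-- The deformation of the path object to `X`, which shortens the paths. -/
def contraction : cyl (pathFactor f) ⟶ pathFactor f :=
  cylHom
    (fun e t => mk (base e) ((path e).comp ⟨fun s => t * s, by fun_prop⟩) (t * scale e)
      (by simp [path_zero]) fun h s => by
        rcases mul_eq_zero.1 h with rfl | h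
        · simp [path_zero]
        · exact path_eq_of_scale_eq_zero h _)
    (by
      refine continuous_iff.2 ⟨?_, ?_, ?_⟩
      · have : Continuous fun w : pathFactor f × I => base w.1 :=
          continuous_base.comp continuous_fst
        exact this
      · exact continuous_eval.comp
          ((continuous_path.comp (continuous_fst.comp continuous_fst)).prodMk
            (g := fun w : (pathFactor f × I) × I => w.1.2 * w.2) (by fun_prop))
      · have : Continuous fun w : pathFactor f × I => scale w.1 :=
          continuous_scale.comp continuous_fst
        exact continuous_snd.mul this)
    fun t e e' h => le_iff.2 ⟨(le_iff.1 h).1, fun s => (le_iff.1 h).2.1 _,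
      congrArg (t * ·) (le_iff.1 h).2.2⟩

lemma contraction_zero (e : pathFactor f) :
    contraction f (cylPoint e 0) = incl f (proj f e) :=
  ext rfl (fun s => by
    change path e (0 * s) = f (base e)
    rw [zero_mul, path_zero]) (zero_mul _)

lemma contraction_one (e : pathFactor f) : contraction f (cylPoint e 1) = e :=
  ext rfl (fun s => congrArg (path e) (one_mul s)) (one_mul _)

lemma llp_difibrations_incl : difibrations.llp (incl f) := by
  refine llp_difibrations_of_deformation (incl f) (proj f) scale continuous_scale
    (fun _ _ h => (le_iff.1 h).2.2) (fun _ => rfl) (incl_proj f)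
    (contraction f) (contraction_zero f)
    (contraction_one f) fun e t h => ext rfl (fun s => ?_) ?_
  · rw [path_eq_of_scale_eq_zero h]
    exact path_eq_of_scale_eq_zero h _
  · rw [h]
    change t * scale e = 0
    rw [h, mul_zero]

lemma dihomotopyEquivalences_incl : dihomotopyEquivalences (incl f) := by
  refine ⟨proj f, ⟨contraction f, contraction_zero f, contraction_one f⟩, ?_⟩
  rw [incl_proj]
  exact (Congruence.equivalence (r := dihomotopyRel)).refl _

/-- The endpoint map is a difibration: a homotopy of the endpoint is lifted by letting the path
follow it. -/
lemma difibrations_endpoint : difibrations (endpoint f) := by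
  rw [difibrations_iff]
  intro Z a H h
  replace h (z : Z) : H (cylPoint z 0) = path (a z) 1 := h z
  -- `P z t` is the path of `a z`, followed by the part of `H (z, ·)` up to time `t`. Rescaling by
  -- `1 + t` makes it equal to the path of `a z` for `t = 0`.
  let P (z : Z) (t s : I) : Y := if (s : ℝ) * (1 + t) ≤ 1 then path (a z) (clamp (s * (1 + t)))
    else H (cylPoint z (clamp (s * (1 + t) - 1)))
  have key (z : Z) (t s : I) (hs : (s : ℝ) * (1 + t) = 1) : path (a z) (clamp (s * (1 + t))) =
      H (cylPoint z (clamp (s * (1 + t) - 1))) := by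
    simp [hs, h]
  have P1 (z : Z) (t s : I) (hs : (s : ℝ) * (1 + t) ≤ 1) :
      P z t s = path (a z) (clamp (s * (1 + t))) := if_pos hs
  have P2 (z : Z) (t s : I) (hs : 1 ≤ (s : ℝ) * (1 + t)) :
      P z t s = H (cylPoint z (clamp (s * (1 + t) - 1))) := by
    rcases hs.eq_or_lt with hs | hs
    · rw [P1 z t s hs.ge, key z t s hs.symm]
    · exact if_neg hs.not_ge
  have cont : Continuous fun w : (Z × I) × I => P w.1.1 w.1.2 w.2 := by
    refine Continuous.if_le ?_ ?_ (by fun_prop) continuous_const fun w hw => key _ _ _ hw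
    · exact continuous_eval.comp ((continuous_path.comp
        ((continuous_hom a).comp (continuous_fst.comp continuous_fst))).prodMk (by fun_prop))
    · exact continuous_cyl H (by fun_prop) (by fun_prop)
  have P0 (z : Z) (t : I) : P z t 0 = f (base (a z)) := by
    rw [P1 z t 0 (by simp)]
    simp [path_zero]
  have Pt (z : Z) (s : I) : P z 0 s = path (a z) s := by
    rw [P1 z 0 s (by simpa using s.2.2)]
    simp
  -- The maximum of `r` and `t` is `r` for `t = 0`, and vanishes only if nothing has been appended
  -- to a constant path.
  refine ⟨cylHom (fun z t => mk (base (a z)) ⟨P z t, cont.comp (.prodMk_right (z, t))⟩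
    (max (scale (a z)) t) (P0 z t) fun hr s => ?_) ?_ ?_, fun z => ?_, ?_⟩
  · have ht : t = 0 := le_antisymm (hr ▸ le_max_right _ _) t.2.1
    have hr' : scale (a z) = 0 := le_antisymm (hr ▸ le_max_left _ _) (scale (a z)).2.1
    subst ht
    exact (Pt z s).trans (path_eq_of_scale_eq_zero hr' s)
  · have ha := continuous_hom a
    exact continuous_iff.2 ⟨(continuous_base.comp ha).comp continuous_fst, cont,
      ((continuous_scale.comp ha).comp continuous_fst).max continuous_snd⟩
  · intro t z z' hz
    have ha := le_iff.1 (monotone_hom a hz)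
    refine le_iff.2 ⟨ha.1, fun s => ?_, congrArg (max · t) ha.2.2⟩
    change P z t s ≤ P z' t s
    rcases le_total ((s : ℝ) * (1 + t)) 1 with hs | hs
    · rw [P1 _ _ _ hs, P1 _ _ _ hs]
      exact ha.2.1 _
    · rw [P2 _ _ _ hs, P2 _ _ _ hs]
      exact monotone_cyl H _ hz
  · exact ext rfl (Pt z) (max_eq_left (scale (a z)).2.1)
  · refine cyl_hom_ext fun z t => ?_
    change P z t 1 = _
    rw [P2 z t 1 (by simpa using t.2.1)]
    simp

end pathFactor

end PathFactor

/-! ### Finite limits and colimits -/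

/-- The product of a family of pospaces. -/
def prodFan {J : Type u} (X : J → PoTop.{u}) : Fan X :=
  Fan.mk (of (∀ j, X j)) fun j => mkHom (fun x => x j) (continuous_apply j) fun _ _ h => h j

/-- The product of a family of pospaces has the universal property. -/
def isLimitProdFan {J : Type u} (X : J → PoTop.{u}) : IsLimit (prodFan X) :=
  Fan.IsLimit.mk _
    (fun s => mkHom (Y := of (∀ j, X j)) (fun x j => s.proj j x)
      (continuous_pi fun j => continuous_hom (s.proj j)) fun _ _ h j => monotone_hom (s.proj j) h)
    (fun _ _ => rfl)
    fun _ _ h => ConcreteCategory.hom_ext _ _ fun x => funext fun j =>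
      ConcreteCategory.congr_hom (h j) x

/-- The disjoint union of a family of pospaces. -/
def sumCofan {J : Type u} (X : J → PoTop.{u}) : Cofan X :=
  Cofan.mk (of (Σ j, X j)) fun j => mkHom (fun x => ⟨j, x⟩)
    (@continuous_sigmaMk J (fun j => X j) _ j)
    fun _ _ h => Sigma.LE.fiber j _ _ h

/-- The disjoint union of a family of pospaces has the universal property. -/
def isColimitSumCofan {J : Type u} (X : J → PoTop.{u}) : IsColimit (sumCofan X) :=
  Cofan.IsColimit.mk _
    (fun s => mkHom (X := of (Σ j, X j)) (fun z => s.inj z.1 z.2)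
      (continuous_sigma fun j => continuous_hom (s.inj j)) (by
        rintro _ _ ⟨j, x, y, h⟩
        exact monotone_hom (s.inj j) h))
    (fun _ _ => rfl)
    fun _ _ h => ConcreteCategory.hom_ext _ _ (by
      rintro ⟨j, x⟩
      exact ConcreteCategory.congr_hom (h j) x)

section Equalizer

variable {X Y : PoTop.{u}} (f g : X ⟶ Y)

/-- The equalizer of two dimaps. -/
def eqFork : Fork f g :=
  Fork.ofι (P := of {x : X // f x = g x})
    (mkHom (fun x => x.1) continuous_subtype_val fun _ _ h => h)
    (ConcreteCategory.hom_ext _ _ fun x => x.2)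

/-- The equalizer of two dimaps has the universal property. -/
def isLimitEqFork : IsLimit (eqFork f g) :=
  Fork.IsLimit.mk _
    (fun s => mkHom (Y := of {x : X // f x = g x})
      (fun x => ⟨s.ι x, ConcreteCategory.congr_hom s.condition x⟩)
      ((continuous_hom s.ι).subtype_mk _) fun _ _ h => monotone_hom s.ι h)
    (fun _ => rfl)
    fun _ _ h => ConcreteCategory.hom_ext _ _ fun x =>
      Subtype.ext (ConcreteCategory.congr_hom h x)

/-- The points of `Y` that no dimap coequalizing `f` and `g` tells apart. -/
def coeqSetoid : Setoid Y where
  r y y' := ∀ (Z : PoTop.{u}) (h : Y ⟶ Z), f ≫ h = g ≫ h → h y = h y'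
  iseqv := ⟨fun _ _ _ _ => rfl, fun H Z h e => (H Z h e).symm,
    fun H H' Z h e => (H Z h e).trans (H' Z h e)⟩

/-- The points of the coequalizer of `f` and `g`. -/
def CoeqCarrier : Type u := _root_.Quotient (coeqSetoid f g)

namespace CoeqCarrier

variable {f g}

/-- The map on the coequalizer that a coequalizing dimap induces. -/
def desc {Z : PoTop.{u}} (h : Y ⟶ Z) (e : f ≫ h = g ≫ h) : CoeqCarrier f g → Z :=
  Quotient.lift (s := coeqSetoid f g) h fun _ _ H => H Z h e

/-- The coequalizer carries the quotient topology. -/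
instance : TopologicalSpace (CoeqCarrier f g) :=
  inferInstanceAs (TopologicalSpace (_root_.Quotient (coeqSetoid f g)))

/-- The coequalizer carries the finest order such that the quotient map is monotone: a relation
holds if it holds in the image of every coequalizing dimap. -/
instance : PartialOrder (CoeqCarrier f g) where
  le q q' := ∀ (Z : PoTop.{u}) (h : Y ⟶ Z) (e : f ≫ h = g ≫ h), desc h e q ≤ desc h e q'
  le_refl _ _ _ _ := le_rfl
  le_trans _ _ _ H H' Z h e := (H Z h e).trans (H' Z h e)
  le_antisymm := by
    rintro ⟨y⟩ ⟨y'⟩ H H'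
    exact Quotient.sound (s := coeqSetoid f g) fun Z h e => le_antisymm (H Z h e) (H' Z h e)

end CoeqCarrier

/-- The coequalizer of two dimaps. -/
def coeqCofork : Cofork f g :=
  Cofork.ofπ (P := of (CoeqCarrier f g))
    (mkHom (fun y => Quotient.mk (coeqSetoid f g) y) continuous_quotient_mk'
      fun _ _ h _ k _ => monotone_hom k h)
    (ConcreteCategory.hom_ext _ _ fun x => Quotient.sound (s := coeqSetoid f g)
      fun _ _ e => ConcreteCategory.congr_hom e x)

/-- The coequalizer of two dimaps has the universal property. -/
def isColimitCoeqCofork : IsColimit (coeqCofork f g) :=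
  Cofork.IsColimit.mk _
    (fun s => mkHom (X := of (CoeqCarrier f g)) (CoeqCarrier.desc s.π s.condition)
      ((continuous_hom s.π).quotient_lift _) fun _ _ h => h _ s.π s.condition)
    (fun _ => rfl)
    fun _ _ h => ConcreteCategory.hom_ext _ _ (by
      rintro ⟨y⟩
      exact ConcreteCategory.congr_hom h y)

end Equalizer

lemma hasFiniteLimits : HasFiniteLimits PoTop.{u} := by
  have : HasProducts.{u} PoTop.{u} := hasProducts_of_limit_fans prodFan isLimitProdFan
  have : HasFiniteProducts PoTop.{u} := hasFiniteProducts_of_hasProducts.{u} _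
  have : HasEqualizers PoTop.{u} :=
    have {X Y : PoTop.{u}} {f g : X ⟶ Y} : HasLimit (parallelPair f g) :=
      ⟨⟨_, isLimitEqFork f g⟩⟩
    hasEqualizers_of_hasLimit_parallelPair _
  exact hasFiniteLimits_of_hasEqualizers_and_finite_products

lemma hasFiniteColimits : HasFiniteColimits PoTop.{u} := by
  have : HasCoproducts.{u} PoTop.{u} := hasCoproducts_of_colimit_cofans sumCofan isColimitSumCofan
  have : HasFiniteCoproducts PoTop.{u} := hasFiniteCoproducts_of_hasCoproducts.{u} _
  have : HasCoequalizers PoTop.{u} :=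
    have {X Y : PoTop.{u}} {f g : X ⟶ Y} : HasColimit (parallelPair f g) :=
      ⟨⟨_, isColimitCoeqCofork f g⟩⟩
    hasCoequalizers_of_hasColimit_parallelPair _
  exact hasFiniteColimits_of_hasCoequalizers_and_finite_coproducts

/-! ### Factorizations and the lifting axioms -/

attribute [local instance] hasFiniteLimits hasFiniteColimits

lemma llp_difibrations_le_dicofibrations : difibrations.{u}.llp ≤ dicofibrations :=
  MorphismProperty.antitone_llp inf_le_left

/-- By the retract argument, a dimap with the left lifting property with respect to difibrations is
a retract of an inclusion into a path object. -/
lemma llp_difibrations_le_dihomotopyEquivalences :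
    difibrations.{u}.llp ≤ dihomotopyEquivalences := fun _ _ i hi =>
  have := hi _ (pathFactor.difibrations_endpoint i)
  MorphismProperty.of_retract (RetractArrow.ofLeftLiftingProperty (pathFactor.incl_endpoint i))
    (pathFactor.dihomotopyEquivalences_incl i)

instance hasFactorization_trivial_dicofibrations_difibrations :
    (dicofibrations.{u} ⊓ dihomotopyEquivalences).HasFactorization difibrations where
  nonempty_mapFactorizationData f :=
    ⟨{ Z := pathFactor f
       i := pathFactor.incl f
       p := pathFactor.endpoint f
       fac := pathFactor.incl_endpoint f
       hi := ⟨llp_difibrations_le_dicofibrations _ (pathFactor.llp_difibrations_incl f),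
         pathFactor.dihomotopyEquivalences_incl f⟩
       hp := pathFactor.difibrations_endpoint f }⟩

/-- Trivial dicofibrations have the left lifting property with respect to difibrations: the
difibration in the path factorization of a trivial dicofibration is trivial, which makes the
dicofibration a retract of the inclusion into the path object. -/
lemma dicofibrations_inf_dihomotopyEquivalences_le :
    dicofibrations.{u} ⊓ dihomotopyEquivalences ≤ difibrations.llp := by
  rintro _ _ i ⟨hi, hi'⟩
  have hp : dihomotopyEquivalences (pathFactor.endpoint i) :=
    MorphismProperty.of_precomp _ _ _ (pathFactor.dihomotopyEquivalences_incl i)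
      (by rwa [pathFactor.incl_endpoint])
  have := hi _ ⟨pathFactor.difibrations_endpoint i, hp⟩
  exact MorphismProperty.of_retract
    (RetractArrow.ofLeftLiftingProperty (pathFactor.incl_endpoint i))
    (pathFactor.llp_difibrations_incl i)

lemma llp_difibrations_cylBot (X : PoTop.{u}) : difibrations.llp (cylBot X) :=
  MorphismProperty.le_llp_rlp _ _ (.mk X)

lemma cylBot_proj (X : PoTop.{u}) : cylBot X ≫ cylProj X = 𝟙 X := rfl

lemma dihomotopyEquivalences_cylProj (X : PoTop.{u}) : dihomotopyEquivalences (cylProj X) :=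
  MorphismProperty.of_precomp _ _ _
    (llp_difibrations_le_dihomotopyEquivalences _ (llp_difibrations_cylBot X))
    (by
      rw [cylBot_proj]
      exact dihomotopyEquivalences_id X)

section MappingCylinder

variable {X Y : PoTop.{u}} (f : X ⟶ Y)

/-- The mapping cylinder of `f : X ⟶ Y`: the bottom of the cylinder on `X` is glued to `Y`
along `f`. -/
noncomputable abbrev mapCyl : PoTop.{u} := pushout (cylBot X) f

/-- The inclusion of `X` as the top of the mapping cylinder. -/
noncomputable def mapCylTop : X ⟶ mapCyl f := cylTop X ≫ pushout.inl (cylBot X) f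

/-- The projection of the mapping cylinder to `Y`. -/
noncomputable def mapCylProj : mapCyl f ⟶ Y :=
  pushout.desc (cylProj X ≫ f) (𝟙 Y) (by
    rw [← Category.assoc, cylBot_proj, Category.id_comp, Category.comp_id])

lemma mapCylTop_proj : mapCylTop f ≫ mapCylProj f = f := by
  rw [mapCylTop, mapCylProj, Category.assoc, pushout.inl_desc]
  rfl

lemma dihomotopyEquivalences_mapCylProj : dihomotopyEquivalences (mapCylProj f) :=
  MorphismProperty.of_precomp _ (pushout.inr (cylBot X) f) _
    (llp_difibrations_le_dihomotopyEquivalences _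
      (MorphismProperty.pushout_inr _ _ (llp_difibrations_cylBot X)))
    (by
      rw [mapCylProj, pushout.inr_desc]
      exact dihomotopyEquivalences_id Y)

/-- The top inclusion is a dicofibration, as trivial difibrations have sections and lift cylinders
relative to both ends. -/
lemma dicofibrations_mapCylTop : dicofibrations (mapCylTop f) := by
  rintro E B p ⟨hp, hw⟩
  refine ⟨fun {a b} sq => ?_⟩
  obtain ⟨s, hs, -⟩ := exists_section_dihomotopicOver hp hw
  -- Use a section on `Y`, and fill in the cylinder between `Y` and the top.
  let y : Y ⟶ E := pushout.inr (cylBot X) f ≫ b ≫ s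
  have hy : y ≫ p = pushout.inr (cylBot X) f ≫ b := by simp [y, hs]
  obtain ⟨F, F0, F1, hF⟩ := exists_cyl_lift hp hw (f ≫ y) a (pushout.inl (cylBot X) f ≫ b)
    (fun x => by
      have e : cylBot X ≫ pushout.inl (cylBot X) f ≫ b = (f ≫ y) ≫ p := by
        rw [Category.assoc, hy, pushout.condition_assoc]
      exact ConcreteCategory.congr_hom e x)
    fun x => ConcreteCategory.congr_hom
      (show cylTop X ≫ pushout.inl (cylBot X) f ≫ b = a ≫ p by
        rw [sq.w, mapCylTop, Category.assoc]) x
  have hF0 : cylBot X ≫ F = f ≫ y := ConcreteCategory.hom_ext _ _ F0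
  refine ⟨⟨⟨pushout.desc F y hF0, ?_, ?_⟩⟩⟩
  · rw [mapCylTop, Category.assoc, pushout.inl_desc]
    exact ConcreteCategory.hom_ext _ _ F1
  · apply pushout.hom_ext
    · rw [pushout.inl_desc_assoc, hF]
    · rw [pushout.inr_desc_assoc, hy]

end MappingCylinder

/-- Factor through the mapping cylinder, and then factor the projection of the mapping cylinder
through its path object. -/
instance hasFactorization_dicofibrations_trivial_difibrations :
    dicofibrations.{u}.HasFactorization (difibrations ⊓ dihomotopyEquivalences) where
  nonempty_mapFactorizationData f :=
    ⟨{ Z := pathFactor (mapCylProj f)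
       i := mapCylTop f ≫ pathFactor.incl (mapCylProj f)
       p := pathFactor.endpoint (mapCylProj f)
       fac := by rw [Category.assoc, pathFactor.incl_endpoint, mapCylTop_proj]
       hi := MorphismProperty.comp_mem (MorphismProperty.llp _) _ _ (dicofibrations_mapCylTop f)
         (llp_difibrations_le_dicofibrations _ (pathFactor.llp_difibrations_incl _))
       hp := ⟨pathFactor.difibrations_endpoint _,
         MorphismProperty.of_precomp _ _ _ (pathFactor.dihomotopyEquivalences_incl _) (by
           rw [pathFactor.incl_endpoint]
           exact dihomotopyEquivalences_mapCylProj f)⟩ }⟩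

/-! ### The model structure -/

/-- The model structure on pospaces: weak equivalences are dihomotopy equivalences, fibrations are
difibrations, and cofibrations are dicofibrations. -/
@[reducible]
noncomputable def modelCategory : ModelCategory PoTop.{u} where
  categoryWithFibrations := ⟨difibrations⟩
  categoryWithCofibrations := ⟨dicofibrations⟩
  categoryWithWeakEquivalences := ⟨dihomotopyEquivalences⟩
  cm2 := inferInstanceAs dihomotopyEquivalences.HasTwoOutOfThreeProperty
  cm3a := inferInstanceAs dihomotopyEquivalences.IsStableUnderRetracts
  cm3b := inferInstanceAs (MorphismProperty.rlp _).IsStableUnderRetracts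
  cm3c := inferInstanceAs (MorphismProperty.llp _).IsStableUnderRetracts
  cm4a := by
    rintro A B X Y i p ⟨hi⟩ ⟨hi'⟩ ⟨hp⟩
    exact dicofibrations_inf_dihomotopyEquivalences_le _ ⟨hi, hi'⟩ _ hp
  cm4b := by
    rintro A B X Y i p ⟨hi⟩ ⟨hp⟩ ⟨hp'⟩
    exact hi _ ⟨hp, hp'⟩
  cm5a := hasFactorization_trivial_dicofibrations_difibrations
  cm5b := hasFactorization_dicofibrations_trivial_difibrations

lemma difibrations_terminal_from (X : PoTop.{u}) : difibrations (terminal.from X) := by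
  rw [difibrations_iff]
  exact fun Z a H _ => ⟨cylProj Z ≫ a, fun _ => rfl, terminal.hom_ext _ _⟩

lemma dicofibrations_initial_to (X : PoTop.{u}) : dicofibrations (initial.to X) := by
  rintro E B p ⟨hp, hw⟩
  refine ⟨fun {a b} _ => ?_⟩
  obtain ⟨s, hs, -⟩ := exists_section_dihomotopicOver hp hw
  exact ⟨⟨⟨b ≫ s, initial.hom_ext _ _, by rw [Category.assoc, hs, Category.comp_id]⟩⟩⟩

lemma dicofibrations_cyl_ends (X : PoTop.{u}) :
    dicofibrations (coprod.desc (cylBot X) (cylTop X)) := by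
  rintro E B p ⟨hp, hw⟩
  refine ⟨fun {a b} sq => ?_⟩
  have h0 : cylBot X ≫ b = (coprod.inl ≫ a) ≫ p := by
    rw [Category.assoc, sq.w, coprod.inl_desc_assoc]
  have h1 : cylTop X ≫ b = (coprod.inr ≫ a) ≫ p := by
    rw [Category.assoc, sq.w, coprod.inr_desc_assoc]
  obtain ⟨F, F0, F1, hF⟩ := exists_cyl_lift hp hw (coprod.inl ≫ a) (coprod.inr ≫ a) b
    (ConcreteCategory.congr_hom h0) (ConcreteCategory.congr_hom h1)
  refine ⟨⟨⟨F, ?_, hF⟩⟩⟩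
  apply coprod.hom_ext
  · rw [coprod.inl_desc_assoc]
    exact ConcreteCategory.hom_ext _ _ F0
  · rw [coprod.inr_desc_assoc]
    exact ConcreteCategory.hom_ext _ _ F1

/-- Two sections of a dihomotopy equivalence are dihomotopic, which applies to the two ends of any
cylinder object. -/
lemma dihomotopic_of_section {X Z : PoTop.{u}} {r : Z ⟶ X} (hr : dihomotopyEquivalences r)
    {i j : X ⟶ Z} (h : i ≫ r = j ≫ r) : Dihomotopic i j := by
  rw [dihomotopyEquivalences_eq] at hr
  have : IsIso (toDihomotopyCategory.map r) := hr
  rw [← toDihomotopyCategory_map_eq_iff, ← cancel_mono (toDihomotopyCategory.map r),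
    ← Functor.map_comp, ← Functor.map_comp, h]

end PoTop

theorem theorem7p2 :
    ∃ _ : ModelCategory PoTop.{u},
      weakEquivalences PoTop.{u} = PoTop.dihomotopyEquivalences ∧
      fibrations PoTop.{u} = PoTop.difibrations ∧
      cofibrations PoTop.{u} = PoTop.dicofibrations ∧
      (∀ X : PoTop.{u}, IsFibrant X) ∧
      (∀ X : PoTop.{u}, IsCofibrant X) ∧
      (∀ (X Y : PoTop.{u}) (f g : X ⟶ Y), ModelHomotopic f g ↔ PoTop.Dihomotopic f g) := by
  let _ : ModelCategory PoTop.{u} := PoTop.modelCategory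
  refine ⟨PoTop.modelCategory, rfl, rfl, rfl, fun X => ⟨PoTop.difibrations_terminal_from X⟩,
    fun X => ⟨PoTop.dicofibrations_initial_to X⟩, fun X Y f g => ⟨?_, ?_⟩⟩
  · rintro ⟨Z, i, r, h, -, ⟨hr⟩, hir, hih⟩
    have key : PoTop.Dihomotopic (coprod.inl ≫ i) (coprod.inr ≫ i) :=
      PoTop.dihomotopic_of_section hr (by
        rw [Category.assoc, Category.assoc, hir, coprod.inl_desc, coprod.inr_desc])
    have := HomRel.comp_right (r := PoTop.dihomotopyRel) h key
    rwa [Category.assoc, Category.assoc, hih, coprod.inl_desc, coprod.inr_desc] at this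
  · rintro ⟨H, H0, H1⟩
    refine ⟨PoTop.cyl X, coprod.desc (PoTop.cylBot X) (PoTop.cylTop X), PoTop.cylProj X, H,
      ⟨PoTop.dicofibrations_cyl_ends X⟩, ⟨PoTop.dihomotopyEquivalences_cylProj X⟩, ?_, ?_⟩
    · rw [coprod.desc_comp]
      rfl
    · rw [coprod.desc_comp]
      congr 1
      · exact ConcreteCategory.hom_ext _ _ H0
      · exact ConcreteCategory.hom_ext _ _ H1
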